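/- Let $n\ge 1$ and let $f\in C([0,1]^n)$ be nonnegative. Write $a_+=\max(a,0)$ and, for $h>0$ and $\Omega\subset\mathbb{R}^n$, $\Omega_h=\Omega\cap(h\mathbb{Z})^n$. The \emph{maximal solution} of the scheme \[\prod_{i=1}^n\bigl(w_h(x)+nx_iD_i^-w_h(x)\bigr)_+=f(x),\quad x\in[0,1]^n_h,\qquad D_i^-w_h(x)=\frac{w_h(x)-w_h(x-he_i)}{h},\] (where the term $nx_iD_i^-w_h(x)$ is $0$ if $x_i=0$) is the function $w_h:[0,1]^n_h\to[0,\infty)$ such that, at each $x\in[0,1]^n_h$, $w_h(x)$ is the largest $t\ge 0$ with \[\prod_{i:\,x_i=0} t_+\prod_{i:\,x_i\neq 0}\Bigl(t+nx_i\frac{t-w_h(x-he_i)}{h}\Bigr)_+=f(x).\] Consider the equation \[\prod_{i=1}^n (w+nx_iw_{x_i})_+=f\quad\text{on }(0,1]^n,\tag{1}\] where viscosity solutions on $(0,1]^n$ are understood with $C^1$ test functions and with local extrema relative to $(0,1]^n$. Then for every $h>0$ the maximal solution $w_h$ exists and is unique. Moreover, (1) has a maximal bounded viscosity solution $w$, that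 is, a bounded viscosity solution with $w'\le w$ on $(0,1]^n$ for every bounded viscosity solution $w'$ of (1); it is given by $w(x)=n^{-1}(x_1\cdots x_n)^{-1/n}u(x)$, where $u\in C([0,1]^n)$ is the (existing and unique) coordinatewise nondecreasing viscosity solution of $\prod_{i=1}^n(u_{x_i})_+=f$ on $(0,1]^n$ with $u=0$ on $\{x\in[0,1]^n: x_i=0\text{ for some }i\}$. Finally, $w_h\to w$ uniformly on $(0,1]^n$ as $h\to0$, that is, \[\lim_{h\to0^+}\ \max_{x\in(0,1]^n_h}|w_h(x)-w(x)|=0 .\] -/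

import Mathlib

open Set

/-- The half-open cube `(0,1]^n`. -/
def cube (n : ℕ) : Set (Fin n → ℝ) := {x | ∀ i, 0 < x i ∧ x i ≤ 1}

/-- The closed cube `[0,1]^n`. -/
def closedCube (n : ℕ) : Set (Fin n → ℝ) := {x | ∀ i, 0 ≤ x i ∧ x i ≤ 1}

/-- `Γ = ∂[0,1]^n \ (0,1]^n`, the points of the closed cube with a vanishing coordinate. -/
def gammaBdry (n : ℕ) : Set (Fin n → ℝ) := {x | x ∈ closedCube n ∧ ∃ i, x i = 0}

/-- The grid `ℤ_h^n`, where `ℤ_h = {h k : k ∈ ℤ}`. -/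
def grid (n : ℕ) (h : ℝ) : Set (Fin n → ℝ) := {x | ∀ i, ∃ k : ℤ, x i = h * k}

/-- The gradient `(φ_{x_1}(x), …, φ_{x_n}(x))`. -/
noncomputable def grad {n : ℕ} (φ : (Fin n → ℝ) → ℝ) (x : Fin n → ℝ) : Fin n → ℝ :=
  fun i => fderiv ℝ φ x (Pi.single i 1)

/-- Viscosity subsolution of `H(x, w, Dw) = 0` on `Ω`; local maxima are relative to `Ω`,
which need not be open. -/
def IsViscositySubsolution {n : ℕ} (H : (Fin n → ℝ) → ℝ → (Fin n → ℝ) → ℝ)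
    (Ω : Set (Fin n → ℝ)) (w : (Fin n → ℝ) → ℝ) : Prop :=
  UpperSemicontinuousOn w Ω ∧
    ∀ x ∈ Ω, ∀ φ : (Fin n → ℝ) → ℝ, ContDiff ℝ 1 φ →
      IsLocalMaxOn (fun y => w y - φ y) Ω x → H x (w x) (grad φ x) ≤ 0

/-- Viscosity supersolution of `H(x, w, Dw) = 0` on `Ω`; local minima are relative to `Ω`. -/
def IsViscositySupersolution {n : ℕ} (H : (Fin n → ℝ) → ℝ → (Fin n → ℝ) → ℝ)
    (Ω : Set (Fin n → ℝ)) (w : (Fin n → ℝ) → ℝ) : Prop :=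
  LowerSemicontinuousOn w Ω ∧
    ∀ x ∈ Ω, ∀ φ : (Fin n → ℝ) → ℝ, ContDiff ℝ 1 φ →
      IsLocalMinOn (fun y => w y - φ y) Ω x → 0 ≤ H x (w x) (grad φ x)

/-- Viscosity solution (in particular continuous on `Ω`). -/
def IsViscositySolution {n : ℕ} (H : (Fin n → ℝ) → ℝ → (Fin n → ℝ) → ℝ)
    (Ω : Set (Fin n → ℝ)) (w : (Fin n → ℝ) → ℝ) : Prop :=
  IsViscositySubsolution H Ω w ∧ IsViscositySupersolution H Ω w

/-- The Hamiltonian of `∏ᵢ (u_{x_i})_+ = f`. -/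
def hamiltonianP1 {n : ℕ} (f : (Fin n → ℝ) → ℝ) (x : Fin n → ℝ) (_z : ℝ) (p : Fin n → ℝ) : ℝ :=
  (∏ i, max (p i) 0) - f x

/-- The Hamiltonian of `∏ᵢ (w + n xᵢ w_{x_i})_+ = f`. -/
def hamiltonianP3 {n : ℕ} (f : (Fin n → ℝ) → ℝ) (x : Fin n → ℝ) (z : ℝ) (p : Fin n → ℝ) : ℝ :=
  (∏ i, max (z + n * x i * p i) 0) - f x

/-- `u ∈ C([0,1]^n)` is a nondecreasing viscosity solution of `∏ᵢ (u_{x_i})_+ = f` on `(0,1]^n`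
with `u = 0` on `Γ`. -/
structure IsNondecreasingSolutionP1 {n : ℕ} (f u : (Fin n → ℝ) → ℝ) : Prop where
  continuousOn : ContinuousOn u (closedCube n)
  monotoneOn : MonotoneOn u (closedCube n)
  viscosity : IsViscositySolution (hamiltonianP1 f) (cube n) u
  boundary : ∀ x ∈ gammaBdry n, u x = 0

/-- `w` is a bounded viscosity solution of `∏ᵢ (w + n xᵢ w_{x_i})_+ = f` on `(0,1]^n`. -/
def IsBoundedSolutionP3 {n : ℕ} (f w : (Fin n → ℝ) → ℝ) : Prop :=
  IsViscositySolution (hamiltonianP3 f) (cube n) w ∧ ∃ C : ℝ, ∀ x ∈ cube n, |w x| ≤ C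

/-- `w` is the maximal bounded viscosity solution: the one above all the others. -/
def IsMaximalBoundedSolutionP3 {n : ℕ} (f w : (Fin n → ℝ) → ℝ) : Prop :=
  IsBoundedSolutionP3 f w ∧
    ∀ w' : (Fin n → ℝ) → ℝ, IsBoundedSolutionP3 f w' → ∀ x ∈ cube n, w' x ≤ w x

/-- The left side `∏ᵢ (t + n xᵢ (t - w(x - h eᵢ)) / h)_+` of the scheme at `x`, with `t` in the
place of `w x`. If `x i = 0`, the value `w (x - h eᵢ)` is multiplied by zero and plays no role. -/
noncomputable def schemeS3 {n : ℕ} (h : ℝ) (w : (Fin n → ℝ) → ℝ) (x : Fin n → ℝ) (t : ℝ) : ℝ :=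
  ∏ i, max (t + n * x i * ((t - w (x - h • Pi.single i 1)) / h)) 0

/-- `w` is the maximal solution of the scheme on `[0,1]^n_h`: at each grid point `x`, the value
`w x` is the largest nonnegative solution of the equation of the scheme at `x`, given the values
of `w` at the preceding grid points. Only the values of `w` on `[0,1]^n_h` matter. -/
def IsMaximalSolutionS3 {n : ℕ} (f : (Fin n → ℝ) → ℝ) (h : ℝ) (w : (Fin n → ℝ) → ℝ) : Prop :=
  ∀ x ∈ closedCube n ∩ grid n h, IsGreatest {t : ℝ | 0 ≤ t ∧ schemeS3 h w x t = f x} (w x)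

/-! The zero-order term of the scheme makes it strictly proper, so two maximal solutions can be
compared directly, even on different grids. Maximality makes every factor nonnegative
(`IsMaximalSolutionS3.factor_nonneg`). Maximise `w x - w' y - A ∑ (x i - y i)²` over pairs of grid
points with meshes `h` and `k`. If the maximum exceeds `δ`, each factor of `w` at `x` exceeds the
corresponding factor of `w'` at `y` by at least `δ / 2`; superadditivity of products
(`prod_add_pow_le_prod`) then gives `f x ≥ f y + (δ / 2) ^ n`, against uniform continuity of `f`. No
boundary condition enters, since the difference terms vanish where `x i = 0`. The estimate
`IsMaximalSolutionS3.sub_le_sum_sq` yields both the Cauchy property as `h → 0` and the continuity of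
the limit `w`, which is a viscosity solution by the usual perturbed-maximum argument.

To identify `w`, put `u = scaledGeomMean n * w`. With `G = (∏ x j)^(1/n)`, the chain rule gives
`u_{x_i} = (G / x_i) (w + n x_i w_{x_i})`, and `∏ G / x_i = 1`, so the two equations correspond.
Nonnegative factors and Bernoulli's inequality make the scaled scheme solutions nondecreasing, hence
also `u`. The comparison principle `IsViscositySubsolution.le_of_monotoneOn` needs monotonicity only
of the supersolution: this gives both the uniqueness of `u` and the maximality of `w`, because any
bounded solution, once scaled, is a subsolution vanishing on `gammaBdry n`. -/

/-! ### The grid and induction along it. -/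

theorem sub_smul_single_apply {n : ℕ} (x : Fin n → ℝ) (h : ℝ) (i j : Fin n) :
    (x - h • (Pi.single i 1 : Fin n → ℝ)) j = x j - if j = i then h else 0 := by
  by_cases hj : j = i
  · subst hj; simp
  · simp [hj]

theorem sub_smul_single_mem {n : ℕ} {h : ℝ} (hh : 0 < h) {x : Fin n → ℝ}
    (hx : x ∈ closedCube n ∩ grid n h) {i : Fin n} (hi : x i ≠ 0) :
    x - h • (Pi.single i 1 : Fin n → ℝ) ∈ closedCube n ∩ grid n h := by
  have hle : h ≤ x i := by
    obtain ⟨k, hk⟩ := hx.2 i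
    have h0 := lt_of_le_of_ne (hx.1 i).1 (Ne.symm hi)
    rw [hk] at h0 ⊢
    have : (0 : ℝ) < k := by
      by_contra hc
      nlinarith
    have h1 : 0 < k := by exact_mod_cast this
    have : (1 : ℝ) ≤ k := by exact_mod_cast h1
    nlinarith
  refine ⟨fun j => ?_, fun j => ?_⟩
  · rw [sub_smul_single_apply]
    have := hx.1 j
    split_ifs with hj
    · subst hj; constructor <;> linarith
    · simpa using this
  · rw [sub_smul_single_apply]
    obtain ⟨k, hk⟩ := hx.2 j
    split_ifs with hj
    · exact ⟨k - 1, by rw [hk]; push_cast; ring⟩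
    · exact ⟨k, by rw [hk]; ring⟩

/-- Induction along the grid in the order in which the scheme determines its solution. -/
theorem grid_induction {n : ℕ} {h : ℝ} (hh : 0 < h) {P : (Fin n → ℝ) → Prop}
    (step : ∀ x ∈ closedCube n ∩ grid n h,
      (∀ i, x i ≠ 0 → P (x - h • (Pi.single i 1 : Fin n → ℝ))) → P x) :
    ∀ x ∈ closedCube n ∩ grid n h, P x := by
  -- A backward step lowers the coordinate sum by exactly `h`, so that sum in units of `h` serves as
  -- the induction measure.
  suffices H : ∀ N : ℕ, ∀ x ∈ closedCube n ∩ grid n h, ∑ j, x j ≤ N * h → P x by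
    intro x hx
    obtain ⟨N, hN⟩ := exists_nat_ge ((∑ j, x j) / h)
    exact H N x hx ((div_le_iff₀ hh).1 hN)
  intro N
  induction N with
  | zero =>
    intro x hx hs
    refine step x hx fun i hi => absurd ?_ hi
    have h0 : ∑ j, x j = 0 :=
      le_antisymm (by simpa using hs) (Finset.sum_nonneg fun j _ => (hx.1 j).1)
    exact (Finset.sum_eq_zero_iff_of_nonneg fun j _ => (hx.1 j).1).1 h0 i (Finset.mem_univ _)
  | succ N ih =>
    intro x hx hs
    refine step x hx fun i hi => ih _ (sub_smul_single_mem hh hx hi) ?_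
    simp only [sub_smul_single_apply, Finset.sum_sub_distrib, Finset.sum_ite_eq',
      Finset.mem_univ, if_true]
    push_cast at hs
    linarith

theorem finite_closedCube_inter_grid (n : ℕ) {h : ℝ} (hh : 0 < h) :
    (closedCube n ∩ grid n h).Finite := by
  refine ((Set.Finite.pi' fun _ : Fin n => Set.finite_Icc (0 : ℤ) ⌈1 / h⌉).image
    fun k i => h * (k i : ℝ)).subset ?_
  rintro x ⟨hx, hg⟩
  choose k hk using hg
  refine ⟨k, fun i => ⟨?_, ?_⟩, funext fun i => (hk i).symm⟩
  · have := (hx i).1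
    rw [hk i] at this
    exact_mod_cast nonneg_of_mul_nonneg_right this hh
  · have := (hx i).2
    rw [hk i] at this
    have h2 : (k i : ℝ) ≤ 1 / h := by rw [le_div_iff₀ hh]; linarith
    exact_mod_cast h2.trans (Int.le_ceil _)

/-! ### Existence, uniqueness and bounds for the maximal scheme solution. -/

theorem schemeS3_congr {n : ℕ} {h : ℝ} {w w' : (Fin n → ℝ) → ℝ} {x : Fin n → ℝ}
    (H : ∀ i, x i ≠ 0 →
      w (x - h • (Pi.single i 1 : Fin n → ℝ)) = w' (x - h • (Pi.single i 1 : Fin n → ℝ))) (t : ℝ) :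
    schemeS3 h w x t = schemeS3 h w' x t := by
  unfold schemeS3
  refine Finset.prod_congr rfl fun i _ => ?_
  by_cases hi : x i = 0
  · simp [hi]
  · rw [H i hi]

theorem pow_le_schemeS3 {n : ℕ} {h : ℝ} (hh : 0 < h) {w : (Fin n → ℝ) → ℝ} {x : Fin n → ℝ}
    (hx : x ∈ closedCube n) {t : ℝ} (ht : 0 ≤ t)
    (hw : ∀ i, x i ≠ 0 → w (x - h • (Pi.single i 1 : Fin n → ℝ)) ≤ t) :
    t ^ n ≤ schemeS3 h w x t := by
  have : t ^ n = ∏ _i : Fin n, t := by simp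
  rw [this]
  refine Finset.prod_le_prod (fun _ _ => ht) fun i _ => le_max_of_le_left ?_
  by_cases hi : x i = 0
  · simp [hi]
  · have h1 := div_nonneg (sub_nonneg.2 (hw i hi)) hh.le
    have h2 := (hx i).1
    have : 0 ≤ n * x i * ((t - w (x - h • (Pi.single i 1 : Fin n → ℝ))) / h) := by positivity
    linarith

/-- The left side vanishes at `t = 0` and exceeds `c` once `t` dominates `1 + c` and all preceding
values; the intermediate value theorem gives a root, and the roots form a compact set. -/
theorem exists_isGreatest_schemeS3 {n : ℕ} (hn : 1 ≤ n) {h : ℝ} (hh : 0 < h)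
    {w : (Fin n → ℝ) → ℝ} (hw : ∀ x, 0 ≤ w x) {x : Fin n → ℝ} (hx : x ∈ closedCube n)
    {c : ℝ} (hc : 0 ≤ c) : ∃ t, IsGreatest {t : ℝ | 0 ≤ t ∧ schemeS3 h w x t = c} t := by
  set M : ℝ := 1 + c + ∑ i, w (x - h • (Pi.single i 1 : Fin n → ℝ)) with hM
  have hs : 0 ≤ ∑ i, w (x - h • (Pi.single i 1 : Fin n → ℝ)) :=
    Finset.sum_nonneg fun i _ => hw _
  have hwM : ∀ i, w (x - h • (Pi.single i 1 : Fin n → ℝ)) ≤ M := fun i => by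
    have := Finset.single_le_sum (f := fun i => w (x - h • (Pi.single i 1 : Fin n → ℝ)))
      (fun i _ => hw _) (Finset.mem_univ i)
    linarith
  have hbig : ∀ t, M ≤ t → c < schemeS3 h w x t := fun t ht => by
    have h1 := pow_le_schemeS3 hh hx (t := t) (by linarith) fun i _ => (hwM i).trans ht
    have h2 := le_self_pow₀ (a := t) (by linarith) (by omega : n ≠ 0)
    linarith
  have hcont : Continuous (schemeS3 h w x) := by
    unfold schemeS3
    fun_prop
  have h0 : schemeS3 h w x 0 ≤ c := by
    refine le_trans (le_of_eq ?_) hc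
    refine Finset.prod_eq_zero (Finset.mem_univ (⟨0, hn⟩ : Fin n)) (max_eq_right ?_)
    have := div_nonneg (hw (x - h • (Pi.single (⟨0, hn⟩ : Fin n) 1 : Fin n → ℝ))) hh.le
    have h3 := (hx ⟨0, hn⟩).1
    rw [zero_sub, neg_div, zero_add, mul_neg]
    exact neg_nonpos.2 (by positivity)
  obtain ⟨t, ht, hte⟩ := intermediate_value_Icc (by linarith : (0 : ℝ) ≤ M)
    hcont.continuousOn ⟨h0, (hbig M le_rfl).le⟩
  have hset : {t : ℝ | 0 ≤ t ∧ schemeS3 h w x t = c} = Icc 0 M ∩ schemeS3 h w x ⁻¹' {c} := by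
    ext s
    refine ⟨fun ⟨h1, h2⟩ => ⟨⟨h1, ?_⟩, h2⟩, fun ⟨h1, h2⟩ => ⟨h1.1, h2⟩⟩
    by_contra! hlt
    exact (hbig s hlt.le).ne' h2
  rw [hset]
  exact (isCompact_Icc.inter_right (isClosed_singleton.preimage hcont)).exists_isGreatest
    ⟨t, ht, hte⟩

theorem exists_isMaximalSolutionS3 {n : ℕ} (hn : 1 ≤ n) {f : (Fin n → ℝ) → ℝ}
    (hf : ∀ x ∈ closedCube n, 0 ≤ f x) {h : ℝ} (hh : 0 < h) :
    ∃ w, IsMaximalSolutionS3 f h w := by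
  -- Iterating `F` from zero stabilises at each grid point after finitely many steps, and the grid
  -- is finite. The default value of `sSup` off the grid is harmless: only nonnegativity is needed
  -- there.
  let F : ((Fin n → ℝ) → ℝ) → (Fin n → ℝ) → ℝ := fun w x =>
    sSup {t : ℝ | 0 ≤ t ∧ schemeS3 h w x t = f x}
  have hpos : ∀ m x, 0 ≤ (F^[m] 0) x := fun m x => by
    cases m with
    | zero => simp
    | succ m =>
      rw [Function.iterate_succ_apply']
      exact Real.sSup_nonneg fun t ht => ht.1
  have hstab : ∀ x ∈ closedCube n ∩ grid n h,
      ∀ᶠ m in Filter.atTop, (F^[m + 1] 0) x = (F^[m] 0) x := by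
    refine grid_induction hh fun x hx ih => ?_
    have hall : ∀ᶠ m in Filter.atTop, ∀ i, x i ≠ 0 →
        (F^[m + 1] 0) (x - h • (Pi.single i 1 : Fin n → ℝ)) =
          (F^[m] 0) (x - h • (Pi.single i 1 : Fin n → ℝ)) := by
      rw [Filter.eventually_all]
      intro i
      by_cases hi : x i = 0
      · simp [hi]
      · filter_upwards [ih i hi] with m hm _ using hm
    obtain ⟨N, hN⟩ := Filter.eventually_atTop.1 hall
    refine Filter.eventually_atTop.2 ⟨N + 1, fun m hm => ?_⟩
    obtain ⟨m, rfl⟩ : ∃ k, m = k + 1 := ⟨m - 1, by omega⟩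
    rw [Function.iterate_succ_apply' F (m + 1)]
    conv_rhs => rw [Function.iterate_succ_apply' F m]
    change sSup {t | 0 ≤ t ∧ schemeS3 h (F^[m + 1] 0) x t = f x} =
      sSup {t | 0 ≤ t ∧ schemeS3 h (F^[m] 0) x t = f x}
    simp only [schemeS3_congr (hN m (by omega))]
  obtain ⟨m, hm⟩ := ((finite_closedCube_inter_grid n hh).eventually_all.2 hstab).exists
  refine ⟨F^[m] 0, fun x hx => ?_⟩
  obtain ⟨t, ht⟩ := exists_isGreatest_schemeS3 hn hh (hpos m) hx.1 (hf x hx.1)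
  have : (F^[m] 0) x = t := by
    rw [← hm x hx, Function.iterate_succ_apply']
    exact ht.csSup_eq
  rwa [this]

theorem IsMaximalSolutionS3.eqOn {n : ℕ} {f : (Fin n → ℝ) → ℝ} {h : ℝ} (hh : 0 < h)
    {w w' : (Fin n → ℝ) → ℝ} (hw : IsMaximalSolutionS3 f h w) (hw' : IsMaximalSolutionS3 f h w') :
    EqOn w w' (closedCube n ∩ grid n h) := by
  refine grid_induction hh fun x hx ih => ?_
  have h1 := hw x hx
  simp only [schemeS3_congr ih] at h1
  exact h1.unique (hw' x hx)

theorem IsMaximalSolutionS3.le {n : ℕ} {f : (Fin n → ℝ) → ℝ} {h : ℝ} (hh : 0 < h)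
    {w : (Fin n → ℝ) → ℝ} (hw : IsMaximalSolutionS3 f h w) (hn : 1 ≤ n) {M : ℝ} (hM : 1 ≤ M)
    (hfM : ∀ x ∈ closedCube n, f x ≤ M) : ∀ x ∈ closedCube n ∩ grid n h, w x ≤ M := by
  refine grid_induction hh fun x hx ih => ?_
  by_contra! hlt
  have h1 := pow_le_schemeS3 hh hx.1 (t := w x) (by linarith) fun i hi => (ih i hi).trans hlt.le
  have h2 := le_self_pow₀ (a := w x) (by linarith) (by omega : n ≠ 0)
  have h3 := (hw x hx).1.2
  have h4 := hfM x hx.1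
  linarith

/-- A negative factor would force `f x = 0`; the larger `t` at which that factor vanishes would then
also solve the equation, contradicting maximality. -/
theorem IsMaximalSolutionS3.factor_nonneg {n : ℕ} {f : (Fin n → ℝ) → ℝ} {h : ℝ} (hh : 0 < h)
    {w : (Fin n → ℝ) → ℝ} (hw : IsMaximalSolutionS3 f h w) {x : Fin n → ℝ}
    (hx : x ∈ closedCube n ∩ grid n h) (i : Fin n) :
    0 ≤ w x + n * x i * ((w x - w (x - h • (Pi.single i 1 : Fin n → ℝ))) / h) := by
  by_contra! hlt
  set v := w (x - h • (Pi.single i 1 : Fin n → ℝ)) with hv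
  have h0 : 0 ≤ w x := (hw x hx).1.1
  have hfx : f x = 0 := by
    rw [← (hw x hx).1.2]
    exact Finset.prod_eq_zero (Finset.mem_univ i) (max_eq_right hlt.le)
  have ha : 0 ≤ n * x i := by have := (hx.1 i).1; positivity
  have hden : 0 < h + n * x i := by linarith
  set t := n * x i * v / (h + n * x i) with ht
  have hlt' : w x < t := by
    rw [ht, lt_div_iff₀ hden]
    have h1 : w x + n * x i * ((w x - v) / h) = (w x * h + n * x i * (w x - v)) / h := by
      field_simp
    rw [h1, div_neg_iff] at hlt
    rcases hlt with hlt | hlt <;> nlinarith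
  refine absurd ((hw x hx).2 ⟨h0.trans hlt'.le, ?_⟩) (not_le.2 hlt')
  rw [hfx]
  refine Finset.prod_eq_zero (Finset.mem_univ i) (max_eq_right (le_of_eq ?_))
  rw [← hv, ht]
  field_simp
  ring

/-! ### Doubling of variables for two mesh sizes. -/

/-- Expanding `∏ (b i + c)` leaves only nonnegative terms besides the two kept. It turns a gap in
every factor into a gap between values of `f`. -/
theorem prod_add_pow_le_prod {n : ℕ} (hn : 1 ≤ n) {a b : Fin n → ℝ} {c : ℝ} (hc : 0 ≤ c)
    (hb : ∀ i, 0 ≤ b i) (hab : ∀ i, b i + c ≤ a i) : ∏ i, b i + c ^ n ≤ ∏ i, a i := by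
  have := Finset.prod_add_prod_le (s := Finset.univ) (f := a) (g := b) (h := fun _ => c)
    (Finset.mem_univ (⟨0, hn⟩ : Fin n)) (hab _) (fun j _ _ => by have := hab j; linarith)
    (fun j _ _ => by have := hab j; have := hb j; linarith) (fun i _ => hb i) (fun _ _ => hc)
  simpa using this

theorem isCompact_closedCube (n : ℕ) : IsCompact (closedCube n) := by
  have : closedCube n = Set.pi univ fun _ => Icc (0 : ℝ) 1 := by
    ext x; simp only [closedCube, Set.mem_pi, mem_univ, true_imp_iff, mem_Icc, mem_ofPred_eq]
  rw [this]
  exact isCompact_univ_pi fun _ => isCompact_Icc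

theorem cube_subset_closedCube (n : ℕ) : cube n ⊆ closedCube n :=
  fun _ hx i => ⟨(hx i).1.le, (hx i).2⟩

theorem dist_lt_of_sum_sq_lt {n : ℕ} {x y : Fin n → ℝ} {r : ℝ} (hr : 0 < r)
    (h : ∑ i, (x i - y i) ^ 2 < r ^ 2) : dist x y < r := by
  rw [dist_pi_lt_iff hr]
  intro i
  have h1 := Finset.single_le_sum (f := fun i => (x i - y i) ^ 2)
    (fun i _ => sq_nonneg _) (Finset.mem_univ i)
  rw [Real.dist_eq]
  exact abs_lt_of_sq_lt_sq (lt_of_le_of_lt h1 h) hr.le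

theorem sum_sq_sub_single {n : ℕ} (x y : Fin n → ℝ) (h : ℝ) (i : Fin n) :
    ∑ j, ((x - h • (Pi.single i 1 : Fin n → ℝ)) j - y j) ^ 2 =
      ∑ j, (x j - y j) ^ 2 - 2 * h * (x i - y i) + h ^ 2 := by
  have : ∀ j, ((x - h • (Pi.single i 1 : Fin n → ℝ)) j - y j) ^ 2 =
      (x j - y j) ^ 2 + if j = i then h ^ 2 - 2 * h * (x j - y j) else 0 := fun j => by
    rw [sub_smul_single_apply]
    split_ifs <;> ring
  simp only [this, Finset.sum_add_distrib, Finset.sum_ite_eq', Finset.mem_univ, if_true]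
  ring

/-- The constants `A` and `h₀` depend neither on the meshes nor on the solutions, so this is at once
a Cauchy estimate in the mesh and an equicontinuity estimate. -/
theorem IsMaximalSolutionS3.sub_le_sum_sq {n : ℕ} (hn : 1 ≤ n) {f : (Fin n → ℝ) → ℝ}
    (hf : ContinuousOn f (closedCube n)) {M : ℝ} (hM : 1 ≤ M)
    (hfM : ∀ x ∈ closedCube n, f x ≤ M) {δ : ℝ} (hδ : 0 < δ) :
    ∃ A > 0, ∃ h₀ > 0, ∀ h k : ℝ, 0 < h → h < h₀ → 0 < k → k < h₀ →
      ∀ w w' : (Fin n → ℝ) → ℝ, IsMaximalSolutionS3 f h w → IsMaximalSolutionS3 f k w' →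
        ∀ x ∈ closedCube n ∩ grid n h, ∀ y ∈ closedCube n ∩ grid n k,
          w x - w' y ≤ δ + A * ∑ i, (x i - y i) ^ 2 := by
  have hn0 : (0 : ℝ) < n := by exact_mod_cast hn
  obtain ⟨ρ, hρ, huc⟩ := Metric.uniformContinuousOn_iff.1
    ((isCompact_closedCube n).uniformContinuousOn_of_continuous hf) ((δ / 2) ^ n) (by positivity)
  -- Large enough to force `dist x y < ρ` at the maximum, since `0 ≤ w' y` and `w x ≤ M`.
  set A := 2 * M / ρ ^ 2 with hA
  have hApos : 0 < A := by positivity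
  refine ⟨A, hApos, δ / (4 * n * A), by positivity, ?_⟩
  intro h k hh hh₀ hk hk₀ w w' hw hw' x₀ hx₀ y₀ hy₀
  by_contra! hcon
  obtain ⟨⟨x, y⟩, ⟨hx, hy⟩, hmax⟩ := Set.exists_max_image
    ((closedCube n ∩ grid n h) ×ˢ (closedCube n ∩ grid n k))
    (fun p => w p.1 - w' p.2 - A * ∑ i, (p.1 i - p.2 i) ^ 2)
    ((finite_closedCube_inter_grid n hh).prod (finite_closedCube_inter_grid n hk))
    ⟨(x₀, y₀), hx₀, hy₀⟩
  simp only at hx hy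
  have h1 := hmax (x₀, y₀) ⟨hx₀, hy₀⟩
  simp only at h1
  have hS : 0 ≤ ∑ i, (x i - y i) ^ 2 := Finset.sum_nonneg fun i _ => sq_nonneg _
  have hAS := mul_nonneg hApos.le hS
  have hdist : dist x y < ρ := by
    apply dist_lt_of_sum_sq_lt hρ
    have h2 := hw.le hh hn hM hfM x hx
    have h3 := (hw' y hy).1.1
    have h4 : A * ∑ i, (x i - y i) ^ 2 < 2 * M := by linarith
    rw [hA, div_mul_eq_mul_div, div_lt_iff₀ (by positivity)] at h4
    nlinarith
  have hf1 := huc x hx.1 y hy.1 hdist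
  rw [Real.dist_eq, abs_lt] at hf1
  have hsmall : n * A * (h + k) ≤ δ / 2 := by
    rw [lt_div_iff₀ (by positivity)] at hh₀ hk₀
    nlinarith
  have hxf : ∀ i, w x + n * x i * (A * (2 * (x i - y i) - h)) ≤
      w x + n * x i * ((w x - w (x - h • (Pi.single i 1 : Fin n → ℝ))) / h) := fun i => by
    by_cases hi : x i = 0
    · simp [hi]
    have h2 := hmax (x - h • (Pi.single i 1 : Fin n → ℝ), y) ⟨sub_smul_single_mem hh hx hi, hy⟩
    simp only [sum_sq_sub_single] at h2
    have h3 : A * (2 * (x i - y i) - h) ≤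
        (w x - w (x - h • (Pi.single i 1 : Fin n → ℝ))) / h := by
      rw [le_div_iff₀ hh]; nlinarith
    have h4 : 0 ≤ n * x i := mul_nonneg hn0.le (hx.1 i).1
    nlinarith
  have hyf : ∀ i, w' y + n * y i * ((w' y - w' (y - k • (Pi.single i 1 : Fin n → ℝ))) / k) ≤
      w' y + n * y i * (A * (2 * (x i - y i) + k)) := fun i => by
    by_cases hi : y i = 0
    · simp [hi]
    have h2 := hmax (x, y - k • (Pi.single i 1 : Fin n → ℝ)) ⟨hx, sub_smul_single_mem hk hy hi⟩
    have hcomm : ∀ z : Fin n → ℝ, ∑ j, (x j - z j) ^ 2 = ∑ j, (z j - x j) ^ 2 := fun z =>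
      Finset.sum_congr rfl fun j _ => by ring
    simp only [hcomm, sum_sq_sub_single] at h2
    have h3 : (w' y - w' (y - k • (Pi.single i 1 : Fin n → ℝ))) / k ≤
        A * (2 * (x i - y i) + k) := by
      rw [div_le_iff₀ hk]; nlinarith
    have h4 : 0 ≤ n * y i := mul_nonneg hn0.le (hy.1 i).1
    nlinarith
  have hprod := prod_add_pow_le_prod hn (c := δ / 2) (by positivity)
    (fun i => hw'.factor_nonneg hk hy i) (a := fun i =>
      w x + n * x i * ((w x - w (x - h • (Pi.single i 1 : Fin n → ℝ))) / h)) fun i => by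
    refine le_trans ?_ (hxf i)
    refine le_trans (add_le_add_left (hyf i) _) ?_
    have h5 : n * A * (x i * h + y i * k) ≤ n * A * (h + k) := by
      have := (hx.1 i).2
      have := (hy.1 i).2
      refine mul_le_mul_of_nonneg_left ?_ (by positivity)
      nlinarith
    -- The penalty enters with a favourable sign: `x i * (x i - y i) - y i * (x i - y i)` is a
    -- square. Only the mesh errors cost anything.
    have h6 : 0 ≤ n * A * (x i - y i) ^ 2 := by positivity
    nlinarith
  have e1 : f x = ∏ i, (w x + n * x i * ((w x - w (x - h • (Pi.single i 1 : Fin n → ℝ))) / h)) := by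
    rw [← (hw x hx).1.2]
    exact Finset.prod_congr rfl fun i _ => max_eq_left (hw.factor_nonneg hh hx i)
  have e2 : f y =
      ∏ i, (w' y + n * y i * ((w' y - w' (y - k • (Pi.single i 1 : Fin n → ℝ))) / k)) := by
    rw [← (hw' y hy).1.2]
    exact Finset.prod_congr rfl fun i _ => max_eq_left (hw'.factor_nonneg hk hy i)
  linarith

/-! ### Uniform convergence to a continuous limit. -/

/-- The grid point obtained by rounding every coordinate down. -/
noncomputable def gridFloor {n : ℕ} (h : ℝ) (x : Fin n → ℝ) : Fin n → ℝ :=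
  fun i => h * (⌊x i / h⌋ : ℝ)

theorem gridFloor_le {n : ℕ} {h : ℝ} (hh : 0 < h) (x : Fin n → ℝ) : gridFloor h x ≤ x := fun i => by
  have := Int.floor_le (x i / h)
  rw [le_div_iff₀ hh] at this
  simp only [gridFloor]
  linarith

theorem gridFloor_mem {n : ℕ} {h : ℝ} (hh : 0 < h) {x : Fin n → ℝ} (hx : x ∈ closedCube n) :
    gridFloor h x ∈ closedCube n ∩ grid n h := by
  refine ⟨fun i => ⟨?_, (gridFloor_le hh x i).trans (hx i).2⟩, fun i => ⟨_, rfl⟩⟩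
  have : (0 : ℝ) ≤ ⌊x i / h⌋ := by exact_mod_cast Int.floor_nonneg.2 (div_nonneg (hx i).1 hh.le)
  exact mul_nonneg hh.le this

theorem gridFloor_mono {n : ℕ} {h : ℝ} (hh : 0 < h) {x y : Fin n → ℝ} (hxy : x ≤ y) :
    gridFloor h x ≤ gridFloor h y := fun i => by
  have : ⌊x i / h⌋ ≤ ⌊y i / h⌋ := Int.floor_mono (div_le_div_of_nonneg_right (hxy i) hh.le)
  exact mul_le_mul_of_nonneg_left (Int.cast_le.2 this) hh.le

theorem dist_gridFloor_le {n : ℕ} {h : ℝ} (hh : 0 < h) (x : Fin n → ℝ) :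
    dist (gridFloor h x) x ≤ h := by
  rw [dist_pi_le_iff hh.le]
  intro i
  have h1 := gridFloor_le hh x i
  have h2 := Int.lt_floor_add_one (x i / h)
  rw [div_lt_iff₀ hh] at h2
  rw [Real.dist_eq, abs_le]
  simp only [gridFloor] at h1 ⊢
  constructor <;> nlinarith

theorem tendsto_gridFloor {n : ℕ} {h : ℕ → ℝ} (hh : ∀ m, 0 < h m)
    (hlim : Filter.Tendsto h Filter.atTop (nhds 0)) (x : Fin n → ℝ) :
    Filter.Tendsto (fun m => gridFloor (h m) x) Filter.atTop (nhds x) :=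
  tendsto_iff_dist_tendsto_zero.2
    (squeeze_zero (fun _ => dist_nonneg) (fun m => dist_gridFloor_le (hh m) x) hlim)

/-- The functions `v h` on the grids of the closed cube converge uniformly to `w`. -/
def GridTendstoUniformly {n : ℕ} (v : ℝ → (Fin n → ℝ) → ℝ) (w : (Fin n → ℝ) → ℝ) : Prop :=
  ∀ ε > 0, ∃ h₀ > 0, ∀ h, 0 < h → h < h₀ → ∀ x ∈ closedCube n ∩ grid n h, |v h x - w x| < ε

theorem exists_gridTendstoUniformly {n : ℕ} (hn : 1 ≤ n) {f : (Fin n → ℝ) → ℝ}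
    (hf : ContinuousOn f (closedCube n)) {M : ℝ} (hM : 1 ≤ M)
    (hfM : ∀ x ∈ closedCube n, f x ≤ M) {v : ℝ → (Fin n → ℝ) → ℝ}
    (hv : ∀ h, 0 < h → IsMaximalSolutionS3 f h (v h)) :
    ∃ w, ContinuousOn w (closedCube n) ∧ (∀ x ∈ closedCube n, 0 ≤ w x ∧ w x ≤ M) ∧
      GridTendstoUniformly v w := by
  have hn0 : (0 : ℝ) < n := by exact_mod_cast hn
  have key := fun δ hδ => IsMaximalSolutionS3.sub_le_sum_sq hn hf hM hfM (δ := δ) hδ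
  set hs : ℕ → ℝ := fun m => 1 / ((m : ℝ) + 1) with hhs
  have hspos : ∀ m, 0 < hs m := fun m => by positivity
  have hslim : Filter.Tendsto hs Filter.atTop (nhds 0) := tendsto_one_div_add_atTop_nhds_zero_nat
  have hfl := fun x : Fin n → ℝ => tendsto_gridFloor hspos hslim x
  have hcauchy : ∀ x ∈ closedCube n, CauchySeq fun m => v (hs m) (gridFloor (hs m) x) := by
    intro x hx
    rw [Metric.cauchySeq_iff]
    intro ε hε
    obtain ⟨A, hA, h₀, hh₀, H⟩ := key (ε / 2) (by positivity)
    have hsq : Filter.Tendsto (fun p : ℕ × ℕ => A * ∑ i,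
        (gridFloor (hs p.1) x i - gridFloor (hs p.2) x i) ^ 2) Filter.atTop (nhds 0) := by
      have h1 : Filter.Tendsto (fun p : ℕ × ℕ => (gridFloor (hs p.1) x, gridFloor (hs p.2) x))
          Filter.atTop (nhds (x, x)) := by
        rw [← Filter.prod_atTop_atTop_eq]
        exact ((hfl x).comp Filter.tendsto_fst).prodMk_nhds ((hfl x).comp Filter.tendsto_snd)
      have h2 : Continuous fun p : (Fin n → ℝ) × (Fin n → ℝ) => A * ∑ i, (p.1 i - p.2 i) ^ 2 := by
        fun_prop
      have h3 := (h2.tendsto (x, x)).comp h1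
      simp only [sub_self, ne_eq, OfNat.ofNat_ne_zero, not_false_eq_true, zero_pow,
        Finset.sum_const_zero, mul_zero] at h3
      exact h3
    have hev := hsq.eventually_lt_const (by positivity : (0 : ℝ) < ε / 2)
    have hsm := hslim.eventually_lt_const hh₀
    obtain ⟨N₁, hN₁⟩ := Filter.eventually_atTop_prod_self'.1 hev
    obtain ⟨N₂, hN₂⟩ := Filter.eventually_atTop.1 hsm
    refine ⟨max N₁ N₂, fun k hk l hl => ?_⟩
    have bound : ∀ k ≥ max N₁ N₂, ∀ l ≥ max N₁ N₂,
        v (hs k) (gridFloor (hs k) x) - v (hs l) (gridFloor (hs l) x) < ε := fun k hk l hl => by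
      have h1 := H (hs k) (hs l) (hspos k) (hN₂ k (le_of_max_le_right hk)) (hspos l)
        (hN₂ l (le_of_max_le_right hl)) _ _ (hv _ (hspos k)) (hv _ (hspos l)) _
        (gridFloor_mem (hspos k) hx) _ (gridFloor_mem (hspos l) hx)
      have h2 := hN₁ k (le_of_max_le_left hk) l (le_of_max_le_left hl)
      simp only at h2
      linarith
    rw [Real.dist_eq, abs_lt]
    have b1 := bound k hk l hl
    have b2 := bound l hl k hk
    constructor <;> linarith
  choose! w hw using fun x hx => cauchySeq_tendsto_of_complete (hcauchy x hx)
  -- Sending only the second mesh to zero along `hs` compares an arbitrary small mesh with `w`, so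
  -- the convergence is not confined to the sequence `hs`.
  have hcmp : ∀ δ > 0, ∃ A > 0, ∃ h₀ > 0, ∀ h, 0 < h → h < h₀ →
      ∀ x ∈ closedCube n ∩ grid n h, ∀ y ∈ closedCube n,
        |v h x - w y| ≤ δ + A * ∑ i, (x i - y i) ^ 2 := by
    intro δ hδ
    obtain ⟨A, hA, h₀, hh₀, H⟩ := key δ hδ
    refine ⟨A, hA, h₀, hh₀, fun h hh hlt x hx y hy => ?_⟩
    have hlim : Filter.Tendsto (fun m => |v h x - v (hs m) (gridFloor (hs m) y)|) Filter.atTop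
        (nhds |v h x - w y|) := ((hw y hy).const_sub _).abs
    have h2 : Continuous fun z : Fin n → ℝ => δ + A * ∑ i, (x i - z i) ^ 2 := by fun_prop
    refine le_of_tendsto_of_tendsto hlim ((h2.tendsto y).comp (hfl y)) ?_
    filter_upwards [hslim.eventually_lt_const hh₀] with m hm
    have a1 := H h (hs m) hh hlt (hspos m) hm _ _ (hv h hh) (hv _ (hspos m)) x hx _
      (gridFloor_mem (hspos m) hy)
    have a2 := H (hs m) h (hspos m) hm hh hlt _ _ (hv _ (hspos m)) (hv h hh) _
      (gridFloor_mem (hspos m) hy) x hx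
    have hcomm : ∑ i, (gridFloor (hs m) y i - x i) ^ 2 = ∑ i, (x i - gridFloor (hs m) y i) ^ 2 :=
      Finset.sum_congr rfl fun j _ => by ring
    rw [hcomm] at a2
    simp only [Function.comp]
    rw [abs_le]
    constructor <;> linarith
  have hww : ∀ δ > 0, ∃ A > 0, ∀ x ∈ closedCube n, ∀ y ∈ closedCube n,
      |w x - w y| ≤ δ + A * ∑ i, (x i - y i) ^ 2 := by
    intro δ hδ
    obtain ⟨A, hA, h₀, hh₀, H⟩ := hcmp δ hδ
    refine ⟨A, hA, fun x hx y hy => ?_⟩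
    have hlim : Filter.Tendsto (fun m => |v (hs m) (gridFloor (hs m) x) - w y|) Filter.atTop
        (nhds |w x - w y|) := ((hw x hx).sub_const _).abs
    have h2 : Continuous fun z : Fin n → ℝ => δ + A * ∑ i, (z i - y i) ^ 2 := by fun_prop
    refine le_of_tendsto_of_tendsto hlim ((h2.tendsto x).comp (hfl x)) ?_
    filter_upwards [hslim.eventually_lt_const hh₀] with m hm
    exact H (hs m) (hspos m) hm _ (gridFloor_mem (hspos m) hx) y hy
  refine ⟨w, ?_, fun x hx => ⟨?_, ?_⟩, ?_⟩
  · intro x hx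
    rw [ContinuousWithinAt, Metric.tendsto_nhdsWithin_nhds]
    intro ε hε
    obtain ⟨A, hA, H⟩ := hww (ε / 2) (by positivity)
    have h2 : Continuous fun z : Fin n → ℝ => A * ∑ i, (z i - x i) ^ 2 := by fun_prop
    have h3 := h2.tendsto x
    simp only [sub_self, ne_eq, OfNat.ofNat_ne_zero, not_false_eq_true, zero_pow,
      Finset.sum_const_zero, mul_zero] at h3
    obtain ⟨r, hr, hr'⟩ := Metric.eventually_nhds_iff.1
      (h3.eventually_lt_const (by positivity : (0 : ℝ) < ε / 2))
    refine ⟨r, hr, fun y hy hd => ?_⟩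
    have := hr' hd
    rw [Real.dist_eq]
    linarith [H y hy x hx]
  · exact ge_of_tendsto' (hw x hx) fun m => (hv _ (hspos m) _ (gridFloor_mem (hspos m) hx)).1.1
  · exact le_of_tendsto' (hw x hx) fun m => (hv _ (hspos m)).le (hspos m) hn hM hfM _
      (gridFloor_mem (hspos m) hx)
  · intro ε hε
    obtain ⟨A, hA, h₀, hh₀, H⟩ := hcmp (ε / 2) (by positivity)
    refine ⟨h₀, hh₀, fun h hh hlt x hx => ?_⟩
    have := H h hh hlt x hx x hx.1
    simp at this
    linarith

/-! ### The limit is a viscosity solution. -/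

theorem GridTendstoUniformly.neg {n : ℕ} {v : ℝ → (Fin n → ℝ) → ℝ} {w : (Fin n → ℝ) → ℝ}
    (H : GridTendstoUniformly v w) : GridTendstoUniformly (fun h x => -v h x) fun x => -w x := by
  intro ε hε
  obtain ⟨h₀, hh₀, H'⟩ := H ε hε
  refine ⟨h₀, hh₀, fun h hh hlt x hx => ?_⟩
  have := H' h hh hlt x hx
  rwa [neg_sub_neg, abs_sub_comm]

theorem eventually_pos_coord {n : ℕ} {x₀ : Fin n → ℝ} (hx₀ : x₀ ∈ cube n) :
    ∀ᶠ x in nhds x₀, ∀ i, 0 < x i := by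
  rw [Filter.eventually_all]
  exact fun i => (continuous_apply i).continuousAt.eventually_const_lt (hx₀ i).1

/-- Local maxima of `w - φ` are approximated by grid points at which the backward differences of
`v h` are almost above the gradient of `φ`. -/
theorem GridTendstoUniformly.exists_backward_difference_ge {n : ℕ} {v : ℝ → (Fin n → ℝ) → ℝ}
    {w : (Fin n → ℝ) → ℝ} (H : GridTendstoUniformly v w) (hw : ContinuousOn w (closedCube n))
    {x₀ : Fin n → ℝ} (hx₀ : x₀ ∈ cube n) {φ : (Fin n → ℝ) → ℝ} (hφ : ContDiff ℝ 1 φ)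
    (hmax : IsLocalMaxOn (fun y => w y - φ y) (cube n) x₀) {η : ℝ} (hη : 0 < η) :
    ∃ h, 0 < h ∧ h < η ∧ ∃ x ∈ cube n ∩ grid n h, dist x x₀ < η ∧ |v h x - w x₀| < η ∧
      ∀ i, h * (grad φ x₀ i - η) ≤ v h x - v h (x - h • (Pi.single i 1 : Fin n → ℝ)) := by
  have hx₀' := cube_subset_closedCube n hx₀
  -- Strict differentiability is used below because the grid maximum `x` moves while the gradient
  -- stays at `x₀`.
  have hφc : Continuous φ := hφ.continuous
  have hstrict := (hφ.contDiffAt (x := x₀)).hasStrictFDerivAt (by simp)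
  obtain ⟨r₁, hr₁, hφr⟩ := Metric.eventually_nhds_iff.1
    (hstrict.isLittleO.def (by positivity : 0 < η / 2))
  have hw0 : ∀ᶠ x in nhds x₀, x ∈ closedCube n → |w x - w x₀| < η / 2 := by
    rw [← eventually_nhdsWithin_iff]
    have := (hw x₀ hx₀').sub_const (w x₀) |>.abs
    simp only [sub_self, abs_zero] at this
    exact this.eventually_lt_const (by positivity)
  obtain ⟨r₂, hr₂, hnear⟩ := Metric.eventually_nhds_iff.1
    ((hw0.and (eventually_pos_coord hx₀)).and (eventually_nhdsWithin_iff.1 hmax))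
  -- With `R ≤ η / 8`, the quadratic perturbation contributes less than `η / 2` to the difference
  -- quotient; the other `η / 2` is the linearisation error of `φ`.
  set R := min (η / 8) (min r₁ r₂) with hR
  have hRpos : 0 < R := by positivity
  have hRη : R ≤ η / 8 := min_le_left _ _
  have hR₁ : R ≤ r₁ := (min_le_right _ _).trans (min_le_left _ _)
  have hR₂ : R ≤ r₂ := (min_le_right _ _).trans (min_le_right _ _)
  have hcont : ContinuousOn (fun x => w x - φ x - ∑ i, (x i - x₀ i) ^ 2) (closedCube n) := by
    refine (hw.sub hφc.continuousOn).sub (Continuous.continuousOn (by fun_prop))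
  have hc0 := hcont x₀ hx₀'
  have hev : ∀ᶠ x in nhds x₀, x ∈ closedCube n →
      w x₀ - φ x₀ - (R / 2) ^ 2 / 2 < w x - φ x - ∑ i, (x i - x₀ i) ^ 2 := by
    rw [← eventually_nhdsWithin_iff]
    refine hc0.eventually_const_lt ?_
    simp only [sub_self, ne_eq, OfNat.ofNat_ne_zero, not_false_eq_true, zero_pow,
      Finset.sum_const_zero, sub_zero]
    linarith [show 0 < (R / 2) ^ 2 by positivity]
  obtain ⟨r₃, hr₃, hnear₃⟩ := Metric.eventually_nhds_iff.1 hev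
  obtain ⟨h₀, hh₀, hu⟩ := H (min (η / 2) ((R / 2) ^ 2 / 4)) (by positivity)
  obtain ⟨h, hh, hlt⟩ := exists_between (show 0 < min (R / 2) (min r₃ h₀) by positivity)
  have hhR : h < R / 2 := hlt.trans_le (min_le_left _ _)
  have hh₃ : h < r₃ := hlt.trans_le ((min_le_right _ _).trans (min_le_left _ _))
  have hhh₀ : h < h₀ := hlt.trans_le ((min_le_right _ _).trans (min_le_right _ _))
  refine ⟨h, hh, by linarith, ?_⟩
  have hp := gridFloor_mem hh hx₀'
  have hpd := dist_gridFloor_le hh x₀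
  obtain ⟨x, ⟨hx, hxR⟩, hxmax⟩ := Set.exists_max_image
    ((closedCube n ∩ grid n h) ∩ Metric.ball x₀ R)
    (fun x => v h x - φ x - ∑ i, (x i - x₀ i) ^ 2)
    ((finite_closedCube_inter_grid n hh).inter_of_left _)
    ⟨gridFloor h x₀, hp, Metric.mem_ball.2 (by linarith)⟩
  rw [Metric.mem_ball] at hxR
  obtain ⟨⟨hxw, hxpos⟩, hxloc⟩ := hnear (hxR.trans_le hR₂)
  have hxcube : x ∈ cube n := fun i => ⟨hxpos i, (hx.1 i).2⟩
  have hux := hu h hh hhh₀ x hx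
  have hup := hu h hh hhh₀ _ hp
  rw [lt_min_iff] at hux hup
  -- The fractions `1/2 + 1/4 + 1/4` of `(R / 2) ^ 2` come from rounding `x₀` and from two uses of
  -- uniform convergence. As `h < R / 2` too, the backward neighbours stay in the ball.
  have hxd : dist x x₀ < R / 2 := by
    refine dist_lt_of_sum_sq_lt (by positivity) ?_
    have a1 := hxmax _ ⟨hp, Metric.mem_ball.2 (by linarith)⟩
    have a2 := hxloc hxcube
    have a3 := hnear₃ (lt_of_le_of_lt hpd hh₃) hp.1
    have a4 := abs_lt.1 hux.2
    have a5 := abs_lt.1 hup.2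
    simp only at a1 a2
    linarith
  refine ⟨x, ⟨hxcube, hx.2⟩, by linarith, ?_, fun i => ?_⟩
  · have a1 := abs_lt.1 hux.1
    have a2 := abs_lt.1 (hxw hx.1)
    rw [abs_lt]
    constructor <;> linarith
  · set y := x - h • (Pi.single i 1 : Fin n → ℝ) with hy
    have hxy : dist y x = h := by
      rw [dist_eq_norm, hy, sub_sub_cancel_left, norm_neg, norm_smul, Pi.norm_single]
      simp [abs_of_pos hh]
    have hyd : dist y x₀ < R := by
      have := dist_triangle y x x₀
      linarith
    have a1 := hxmax y ⟨sub_smul_single_mem hh hx (hxpos i).ne', Metric.mem_ball.2 hyd⟩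
    have a2 := @hφr (x, y) (by
      rw [Prod.dist_eq]
      exact max_lt (hxR.trans_le hR₁) (hyd.trans_le hR₁))
    have e1 : x - y = h • (Pi.single i 1 : Fin n → ℝ) := by rw [hy]; abel
    have e2 : ‖x - y‖ = h := by rw [← dist_eq_norm, dist_comm]; exact hxy
    simp only [e2, Real.norm_eq_abs] at a2
    rw [e1, map_smul, smul_eq_mul] at a2
    have a3 := (abs_le.1 a2).1
    have a4 : |x i - x₀ i| < R / 2 := by
      rw [← Real.dist_eq]
      exact (dist_le_pi_dist x x₀ i).trans_lt hxd
    have a5 := abs_lt.1 a4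
    simp only [hy, sum_sq_sub_single] at a1
    rw [← hy] at a1
    change h * (fderiv ℝ φ x₀ (Pi.single i 1) - η) ≤ _
    nlinarith

/-- The scheme's left side is nondecreasing in each backward difference, so one-sided bounds on
these differences pass to the limit. Minima reduce to maxima by changing signs. -/
theorem viscosity_limit {n : ℕ} {f : (Fin n → ℝ) → ℝ}
    (hf : ContinuousOn f (closedCube n)) {v : ℝ → (Fin n → ℝ) → ℝ}
    (hv : ∀ h, 0 < h → IsMaximalSolutionS3 f h (v h)) {w : (Fin n → ℝ) → ℝ}
    (H : GridTendstoUniformly v w) (hw : ContinuousOn w (closedCube n)) :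
    IsViscositySolution (hamiltonianP3 f) (cube n) w := by
  have hwc := hw.mono (cube_subset_closedCube n)
  have hlim := tendsto_one_div_add_atTop_nhds_zero_nat (𝕜 := ℝ)
  have hpos : ∀ m : ℕ, 0 < 1 / ((m : ℝ) + 1) := fun m => by positivity
  refine ⟨⟨hwc.upperSemicontinuousOn, fun x₀ hx₀ φ hφ hmax => ?_⟩,
    hwc.lowerSemicontinuousOn, fun x₀ hx₀ φ hφ hmin => ?_⟩
  · have hx₀' := cube_subset_closedCube n hx₀
    choose h hh hhlt x hx hxd hvx hd using fun m : ℕ =>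
      H.exists_backward_difference_ge hw hx₀ hφ hmax (hpos m)
    have hxlim : Filter.Tendsto x Filter.atTop (nhds x₀) := tendsto_iff_dist_tendsto_zero.2
      (squeeze_zero (fun _ => dist_nonneg) (fun m => (hxd m).le) hlim)
    have hvlim : Filter.Tendsto (fun m => v (h m) (x m)) Filter.atTop (nhds (w x₀)) :=
      tendsto_iff_dist_tendsto_zero.2
        (squeeze_zero (fun _ => dist_nonneg) (fun m => (hvx m).le) hlim)
    have hxK := fun m => cube_subset_closedCube n (hx m).1
    have hflim := (hf x₀ hx₀').tendsto.comp
      (tendsto_nhdsWithin_iff.2 ⟨hxlim, Filter.Eventually.of_forall hxK⟩)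
    have hprod : Filter.Tendsto (fun m : ℕ => ∏ i, max (v (h m) (x m) +
        n * x m i * (grad φ x₀ i - 1 / ((m : ℝ) + 1))) 0) Filter.atTop
        (nhds (∏ i, max (w x₀ + n * x₀ i * (grad φ x₀ i - 0)) 0)) := by
      refine tendsto_finsetProd _ fun i _ => Filter.Tendsto.max ?_ tendsto_const_nhds
      exact hvlim.add (((tendsto_pi_nhds.1 hxlim i).const_mul _).mul (hlim.const_sub _))
    have := le_of_tendsto_of_tendsto' hprod hflim fun m => by
      have hmem : x m ∈ closedCube n ∩ grid n (h m) := ⟨hxK m, (hx m).2⟩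
      rw [Function.comp, ← (hv _ (hh m) _ hmem).1.2]
      refine Finset.prod_le_prod (fun _ _ => le_max_right _ _) fun i _ => max_le_max_right _ ?_
      have h1 := (le_div_iff₀' (hh m)).2 (hd m i)
      have h2 : 0 ≤ n * x m i := mul_nonneg n.cast_nonneg (hxK m i).1
      linarith [mul_le_mul_of_nonneg_left h1 h2]
    simp only [sub_zero] at this
    exact sub_nonpos.2 this
  · have hx₀' := cube_subset_closedCube n hx₀
    have hmax : IsLocalMaxOn (fun y => -w y - -φ y) (cube n) x₀ := by
      filter_upwards [hmin] with y hy
      linarith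
    choose h hh hhlt x hx hxd hvx hd using fun m : ℕ =>
      H.neg.exists_backward_difference_ge hw.neg hx₀ hφ.neg hmax (hpos m)
    have hxlim : Filter.Tendsto x Filter.atTop (nhds x₀) := tendsto_iff_dist_tendsto_zero.2
      (squeeze_zero (fun _ => dist_nonneg) (fun m => (hxd m).le) hlim)
    have hvlim : Filter.Tendsto (fun m => v (h m) (x m)) Filter.atTop (nhds (w x₀)) :=
      tendsto_iff_dist_tendsto_zero.2
        (squeeze_zero (fun _ => dist_nonneg) (fun m => by
          rw [dist_comm, Real.dist_eq, ← neg_sub_neg]; exact (hvx m).le) hlim)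
    have hxK := fun m => cube_subset_closedCube n (hx m).1
    have hflim := (hf x₀ hx₀').tendsto.comp
      (tendsto_nhdsWithin_iff.2 ⟨hxlim, Filter.Eventually.of_forall hxK⟩)
    have hprod : Filter.Tendsto (fun m : ℕ => ∏ i, max (v (h m) (x m) +
        n * x m i * (grad φ x₀ i + 1 / ((m : ℝ) + 1))) 0) Filter.atTop
        (nhds (∏ i, max (w x₀ + n * x₀ i * (grad φ x₀ i + 0)) 0)) := by
      refine tendsto_finsetProd _ fun i _ => Filter.Tendsto.max ?_ tendsto_const_nhds
      exact hvlim.add (((tendsto_pi_nhds.1 hxlim i).const_mul _).mul (hlim.const_add _))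
    have := le_of_tendsto_of_tendsto' hflim hprod fun m => by
      have hmem : x m ∈ closedCube n ∩ grid n (h m) := ⟨hxK m, (hx m).2⟩
      rw [Function.comp, ← (hv _ (hh m) _ hmem).1.2]
      refine Finset.prod_le_prod (fun _ _ => le_max_right _ _) fun i _ => max_le_max_right _ ?_
      have hg : grad (fun y => -φ y) x₀ i = -grad φ x₀ i := by
        simp [grad, fderiv_fun_neg]
      have h0 := hd m i
      have h1 : (v (h m) (x m) - v (h m) (x m - h m • (Pi.single i 1 : Fin n → ℝ))) / h m ≤
          grad φ x₀ i + 1 / ((m : ℝ) + 1) := by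
        rw [div_le_iff₀ (hh m)]
        rw [hg] at h0
        linarith
      have h2 : 0 ≤ n * x m i := mul_nonneg n.cast_nonneg (hxK m i).1
      linarith [mul_le_mul_of_nonneg_left h1 h2]
    simp only [add_zero] at this
    exact sub_nonneg.2 this

/-! ### Change of unknown by the scaled geometric mean. -/

/-- Test functions must be globally `C¹`, whereas quotients by `scaledGeomMean` are smooth only near
points with positive coordinates; a bump function bridges the gap. -/
theorem ContDiffAt.exists_contDiff_eventuallyEq {n : ℕ} {φ : (Fin n → ℝ) → ℝ} {x₀ : Fin n → ℝ}
    (hφ : ContDiffAt ℝ 1 φ x₀) : ∃ ψ : (Fin n → ℝ) → ℝ, ContDiff ℝ 1 ψ ∧ ψ =ᶠ[nhds x₀] φ := by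
  obtain ⟨r, hr, hball⟩ := Metric.eventually_nhds_iff.1 (hφ.eventually (by simp))
  let b : ContDiffBump x₀ := ⟨r / 4, r / 2, by positivity, by linarith⟩
  refine ⟨fun x => b x * φ x, contDiff_iff_contDiffAt.2 fun x => ?_, ?_⟩
  · by_cases hx : x ∈ tsupport b
    · rw [b.tsupport_eq, Metric.mem_closedBall] at hx
      refine b.contDiffAt.mul (hball (lt_of_le_of_lt hx ?_))
      change r / 2 < r
      linarith
    · have h0 : (fun x => b x * φ x) =ᶠ[nhds x] fun _ => 0 := by
        filter_upwards [notMem_tsupport_iff_eventuallyEq.1 hx] with y hy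
        simp [hy]
      exact contDiffAt_const.congr_of_eventuallyEq h0
  · filter_upwards [b.eventuallyEq_one] with y hy
    simp [hy]

/-- The function `n (x₁ ⋯ xₙ)^(1/n)`. -/
noncomputable def scaledGeomMean (n : ℕ) (x : Fin n → ℝ) : ℝ := n * (∏ i, x i) ^ (1 / (n : ℝ))

theorem continuous_scaledGeomMean (n : ℕ) : Continuous (scaledGeomMean n) := by
  unfold scaledGeomMean
  refine continuous_const.mul (Continuous.rpow_const (by fun_prop) fun _ => Or.inr (by positivity))

theorem scaledGeomMean_nonneg {n : ℕ} {x : Fin n → ℝ} (hx : x ∈ closedCube n) :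
    0 ≤ scaledGeomMean n x :=
  mul_nonneg n.cast_nonneg (Real.rpow_nonneg (Finset.prod_nonneg fun i _ => (hx i).1) _)

theorem scaledGeomMean_pos {n : ℕ} (hn : 1 ≤ n) {x : Fin n → ℝ} (hx : ∀ i, 0 < x i) :
    0 < scaledGeomMean n x :=
  mul_pos (by exact_mod_cast hn) (Real.rpow_pos_of_pos (Finset.prod_pos fun i _ => hx i) _)

theorem scaledGeomMean_eq_zero {n : ℕ} (hn : 1 ≤ n) {x : Fin n → ℝ} (hx : x ∈ gammaBdry n) :
    scaledGeomMean n x = 0 := by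
  obtain ⟨i, hi⟩ := hx.2
  have hn0 : (n : ℝ) ≠ 0 := by positivity
  rw [scaledGeomMean, Finset.prod_eq_zero (Finset.mem_univ i) hi, Real.zero_rpow (by positivity),
    mul_zero]

theorem contDiffAt_scaledGeomMean {n : ℕ} {x : Fin n → ℝ} (hx : ∀ i, 0 < x i) :
    ContDiffAt ℝ 1 (scaledGeomMean n) x := by
  unfold scaledGeomMean
  refine contDiffAt_const.mul (ContDiffAt.rpow_const_of_ne ?_ (Finset.prod_pos fun i _ => hx i).ne')
  exact (contDiff_prod fun i _ => contDiff_apply ℝ ℝ i).contDiffAt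

theorem grad_scaledGeomMean {n : ℕ} (hn : 1 ≤ n) {x : Fin n → ℝ} (hx : ∀ i, 0 < x i) (i : Fin n) :
    grad (scaledGeomMean n) x i = (∏ j, x j) ^ (1 / (n : ℝ)) / x i := by
  have hn0 : (n : ℝ) ≠ 0 := by positivity
  have hP : 0 < ∏ j, x j := Finset.prod_pos fun i _ => hx i
  have h1 : HasFDerivAt (fun x : Fin n → ℝ => ∏ j, x j) _ x :=
    hasFDerivAt_finsetProd (𝕜 := ℝ)
  have h2 := ((h1.rpow_const (p := 1 / (n : ℝ)) (Or.inl hP.ne')).const_mul (n : ℝ))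
  have h3 : HasFDerivAt (scaledGeomMean n) _ x := h2
  rw [grad, h3.fderiv]
  have h4 : (∏ j ∈ Finset.univ.erase i, x j) = (∏ j, x j) / x i := by
    rw [eq_div_iff (hx i).ne', mul_comm, Finset.mul_prod_erase _ _ (Finset.mem_univ i)]
  simp only [_root_.smul_apply, _root_.sum_apply, smul_eq_mul,
    ContinuousLinearMap.proj_apply, Pi.single_apply]
  simp only [mul_ite, mul_one, mul_zero, Finset.sum_ite_eq', Finset.mem_univ, if_true]
  rw [h4, Real.rpow_sub_one hP.ne']
  field_simp

theorem prod_grad_eq_of_eventuallyEq_mul {n : ℕ} (hn : 1 ≤ n) {x₀ : Fin n → ℝ}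
    (hx₀ : ∀ i, 0 < x₀ i) {φ θ : (Fin n → ℝ) → ℝ} (hθ : DifferentiableAt ℝ θ x₀)
    (h : φ =ᶠ[nhds x₀] fun x => scaledGeomMean n x * θ x) :
    ∏ i, max (grad φ x₀ i) 0 = ∏ i, max (θ x₀ + n * x₀ i * grad θ x₀ i) 0 := by
  have hn0 : (n : ℝ) ≠ 0 := by positivity
  have hP : 0 < ∏ j, x₀ j := Finset.prod_pos fun i _ => hx₀ i
  have hG : 0 < (∏ j, x₀ j) ^ (1 / (n : ℝ)) := Real.rpow_pos_of_pos hP _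
  have hgd := (contDiffAt_scaledGeomMean hx₀).differentiableAt (by simp)
  have hgrad : ∀ i, max (grad φ x₀ i) 0 =
      ((∏ j, x₀ j) ^ (1 / (n : ℝ)) / x₀ i) * max (θ x₀ + n * x₀ i * grad θ x₀ i) 0 := fun i => by
    have h1 : grad φ x₀ i =
        scaledGeomMean n x₀ * grad θ x₀ i + θ x₀ * grad (scaledGeomMean n) x₀ i := by
      simp only [grad, h.fderiv_eq, fderiv_fun_mul hgd hθ]
      simp
    rw [h1, grad_scaledGeomMean hn hx₀, mul_max_of_nonneg _ _ (div_pos hG (hx₀ i)).le, mul_zero]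
    congr 1
    have := (hx₀ i).ne'
    rw [scaledGeomMean]
    field_simp
    ring
  simp only [hgrad]
  rw [Finset.prod_mul_distrib, Finset.prod_div_distrib, Finset.prod_const, Finset.card_univ,
    Fintype.card_fin, one_div, Real.rpow_inv_natCast_pow hP.le (by omega), div_self hP.ne', one_mul]

/-- Transfers a test function for `scaledGeomMean n * w` to one for `w`; the constant `c` is later
chosen to make the functions touch at `x₀`. -/
theorem exists_test_function_div {n : ℕ} (hn : 1 ≤ n) {x₀ : Fin n → ℝ} (hx₀ : ∀ i, 0 < x₀ i)
    {φ : (Fin n → ℝ) → ℝ} (hφ : ContDiff ℝ 1 φ) (c : ℝ) :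
    ∃ θ : (Fin n → ℝ) → ℝ, ContDiff ℝ 1 θ ∧
      (∀ᶠ x in nhds x₀, 0 < scaledGeomMean n x ∧ φ x + c = scaledGeomMean n x * θ x) ∧
      ∏ i, max (grad φ x₀ i) 0 = ∏ i, max (θ x₀ + n * x₀ i * grad θ x₀ i) 0 := by
  have hg := scaledGeomMean_pos hn hx₀
  have hc : ContDiffAt ℝ 1 (fun x => (φ x + c) / scaledGeomMean n x) x₀ :=
    (hφ.contDiffAt.add contDiffAt_const).div (contDiffAt_scaledGeomMean hx₀) hg.ne'
  obtain ⟨θ, hθ, hθe⟩ := hc.exists_contDiff_eventuallyEq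
  have hev : ∀ᶠ x in nhds x₀, 0 < scaledGeomMean n x ∧ φ x + c = scaledGeomMean n x * θ x := by
    filter_upwards [hθe, (continuous_scaledGeomMean n).continuousAt.eventually_const_lt hg]
      with x h1 h2
    rw [h1]
    exact ⟨h2, by field_simp⟩
  refine ⟨θ, hθ, hev, ?_⟩
  rw [← prod_grad_eq_of_eventuallyEq_mul hn hx₀ (hθ.contDiffAt.differentiableAt (by simp))
    (hev.mono fun x hx => hx.2)]
  simp only [grad, fderiv_add_const]

theorem IsViscositySubsolution.scaledGeomMean_mul {n : ℕ} (hn : 1 ≤ n) {f w : (Fin n → ℝ) → ℝ}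
    (hwc : ContinuousOn w (cube n)) (hw : IsViscositySubsolution (hamiltonianP3 f) (cube n) w) :
    IsViscositySubsolution (hamiltonianP1 f) (cube n) fun x => scaledGeomMean n x * w x := by
  refine ⟨((continuous_scaledGeomMean n).continuousOn.mul hwc).upperSemicontinuousOn,
    fun x₀ hx₀ φ hφ hmax => ?_⟩
  obtain ⟨θ, hθ, hev, hprod⟩ := exists_test_function_div hn (fun i => (hx₀ i).1) hφ
    (scaledGeomMean n x₀ * w x₀ - φ x₀)
  obtain ⟨hg0, he0⟩ := hev.self_of_nhds
  have hθ0 : w x₀ = θ x₀ := mul_left_cancel₀ hg0.ne' (by linarith)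
  have := hw.2 x₀ hx₀ θ hθ (by
    filter_upwards [hmax, nhdsWithin_le_nhds hev] with x h1 h2
    have h3 : scaledGeomMean n x * w x ≤ scaledGeomMean n x * θ x := by linarith
    linarith [le_of_mul_le_mul_left h3 h2.1])
  rw [hamiltonianP3, hθ0, ← hprod] at this
  exact this

theorem IsViscositySupersolution.scaledGeomMean_mul {n : ℕ} (hn : 1 ≤ n) {f w : (Fin n → ℝ) → ℝ}
    (hwc : ContinuousOn w (cube n)) (hw : IsViscositySupersolution (hamiltonianP3 f) (cube n) w) :
    IsViscositySupersolution (hamiltonianP1 f) (cube n) fun x => scaledGeomMean n x * w x := by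
  refine ⟨((continuous_scaledGeomMean n).continuousOn.mul hwc).lowerSemicontinuousOn,
    fun x₀ hx₀ φ hφ hmin => ?_⟩
  obtain ⟨θ, hθ, hev, hprod⟩ := exists_test_function_div hn (fun i => (hx₀ i).1) hφ
    (scaledGeomMean n x₀ * w x₀ - φ x₀)
  obtain ⟨hg0, he0⟩ := hev.self_of_nhds
  have hθ0 : w x₀ = θ x₀ := mul_left_cancel₀ hg0.ne' (by linarith)
  have := hw.2 x₀ hx₀ θ hθ (by
    filter_upwards [hmin, nhdsWithin_le_nhds hev] with x h1 h2
    have h3 : scaledGeomMean n x * θ x ≤ scaledGeomMean n x * w x := by linarith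
    linarith [le_of_mul_le_mul_left h3 h2.1])
  rw [hamiltonianP3, hθ0, ← hprod] at this
  exact this

/-- Boundedness of `w` matters here: the weight vanishes on `gammaBdry n` and absorbs any behaviour
of `w` near it. -/
theorem continuousOn_scaledGeomMean_mul {n : ℕ} (hn : 1 ≤ n) {w : (Fin n → ℝ) → ℝ}
    (hw : ContinuousOn w (cube n)) {C : ℝ} (hC : ∀ x ∈ cube n, |w x| ≤ C) :
    ContinuousOn (fun x => scaledGeomMean n x * w x) (closedCube n) := by
  intro x hx
  by_cases hpos : ∀ i, 0 < x i
  · have hxc : x ∈ cube n := fun i => ⟨hpos i, (hx i).2⟩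
    have h1 : ContinuousWithinAt w (closedCube n) x := by
      refine (hw x hxc).mono_of_mem_nhdsWithin ?_
      filter_upwards [self_mem_nhdsWithin, nhdsWithin_le_nhds (eventually_pos_coord hxc)]
        with y h1 h2 i using ⟨h2 i, (h1 i).2⟩
    exact (continuous_scaledGeomMean n).continuousWithinAt.mul h1
  · push Not at hpos
    obtain ⟨i, hi⟩ := hpos
    have h0 := scaledGeomMean_eq_zero hn ⟨hx, i, le_antisymm hi (hx i).1⟩
    have hlim : Filter.Tendsto (fun y => scaledGeomMean n y * C) (nhdsWithin x (closedCube n))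
        (nhds 0) := by
      have := ((continuous_scaledGeomMean n).tendsto x).mul_const C
      rw [h0, zero_mul] at this
      exact this.mono_left nhdsWithin_le_nhds
    rw [ContinuousWithinAt, h0, zero_mul]
    refine squeeze_zero_norm' ?_ hlim
    filter_upwards [self_mem_nhdsWithin] with y hy
    rw [norm_mul, Real.norm_of_nonneg (scaledGeomMean_nonneg hy), Real.norm_eq_abs]
    by_cases hyc : ∀ i, 0 < y i
    · exact mul_le_mul_of_nonneg_left (hC y fun i => ⟨hyc i, (hy i).2⟩) (scaledGeomMean_nonneg hy)
    · push Not at hyc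
      obtain ⟨j, hj⟩ := hyc
      rw [scaledGeomMean_eq_zero hn ⟨hy, j, le_antisymm hj (hy j).1⟩, zero_mul, zero_mul]

/-! ### Monotonicity of the scaled solutions. -/

/-- Put `a = h / (n x i)`. By Bernoulli, a backward step multiplies the weight by at most `1 - a`;
the nonnegative factor gives `w y ≤ (1 + a) * w x`; and `(1 - a) * (1 + a) ≤ 1`. -/
theorem IsMaximalSolutionS3.scaledGeomMean_mul_sub_le {n : ℕ} (hn : 1 ≤ n)
    {f : (Fin n → ℝ) → ℝ} {h : ℝ} (hh : 0 < h) {w : (Fin n → ℝ) → ℝ}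
    (hw : IsMaximalSolutionS3 f h w) {x : Fin n → ℝ} (hx : x ∈ closedCube n ∩ grid n h)
    {i : Fin n} (hi : x i ≠ 0) :
    scaledGeomMean n (x - h • (Pi.single i 1 : Fin n → ℝ)) * w (x - h • (Pi.single i 1 : Fin n → ℝ))
      ≤ scaledGeomMean n x * w x := by
  have hn1 : (1 : ℝ) ≤ n := by exact_mod_cast hn
  have hn0 : (0 : ℝ) < n := by linarith
  have hxi : 0 < x i := lt_of_le_of_ne (hx.1 i).1 hi.symm
  set y := x - h • (Pi.single i 1 : Fin n → ℝ) with hy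
  have hymem := sub_smul_single_mem hh hx hi
  have hle : h ≤ x i := by
    have := (hymem.1 i).1
    rw [sub_smul_single_apply] at this
    simpa using this
  have hs1 : h / x i ≤ 1 := (div_le_one hxi).2 hle
  have hs0 : 0 < h / x i := by positivity
  have hprod : ∏ j, y j = (∏ j, x j) * (1 + -(h / x i)) := by
    have : ∀ j, y j = x j * if j = i then 1 + -(h / x j) else 1 := fun j => by
      rw [hy, sub_smul_single_apply]
      split_ifs with hj
      · rw [hj]; field_simp; ring
      · ring
    simp only [this, Finset.prod_mul_distrib, Finset.prod_ite_eq', Finset.mem_univ, if_true]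
  have hbern := rpow_one_add_le_one_add_mul_self (s := -(h / x i)) (p := 1 / (n : ℝ))
    (by linarith) (by positivity) ((div_le_one hn0).2 hn1)
  have hgy : scaledGeomMean n y ≤ scaledGeomMean n x * (1 - 1 / n * (h / x i)) := by
    rw [scaledGeomMean, hprod, Real.mul_rpow (Finset.prod_nonneg fun j _ => (hx.1 j).1)
      (by linarith), ← mul_assoc]
    exact mul_le_mul_of_nonneg_left (by linarith) (scaledGeomMean_nonneg hx.1)
  have hwy : 0 ≤ w y := (hw y hymem).1.1
  have hwx : 0 ≤ w x := (hw x hx).1.1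
  have hfac := hw.factor_nonneg hh hx i
  rw [← hy] at hfac
  set a := 1 / n * (h / x i) with ha
  have ha0 : 0 < a := by positivity
  have ha1 : a ≤ 1 := by
    have : 1 / (n : ℝ) ≤ 1 := (div_le_one hn0).2 hn1
    rw [ha]
    nlinarith
  have hwle : w y ≤ (1 + a) * w x := by
    have e : w x + n * x i * ((w x - w y) / h) = ((1 + a) * w x - w y) / a := by
      rw [ha]; field_simp; ring
    rw [e] at hfac
    have := (div_nonneg_iff.1 hfac).resolve_right (by rintro ⟨_, h2⟩; linarith)
    linarith [this.1]
  calc scaledGeomMean n y * w y ≤ scaledGeomMean n x * (1 - a) * w y :=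
        mul_le_mul_of_nonneg_right hgy hwy
    _ = scaledGeomMean n x * ((1 - a) * w y) := by ring
    _ ≤ scaledGeomMean n x * w x := by
        refine mul_le_mul_of_nonneg_left ?_ (scaledGeomMean_nonneg hx.1)
        nlinarith [mul_le_mul_of_nonneg_left hwle (sub_nonneg.2 ha1), mul_nonneg hwx (sq_nonneg a)]

theorem IsMaximalSolutionS3.monotoneOn_scaledGeomMean_mul {n : ℕ} (hn : 1 ≤ n)
    {f : (Fin n → ℝ) → ℝ} {h : ℝ} (hh : 0 < h) {w : (Fin n → ℝ) → ℝ}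
    (hw : IsMaximalSolutionS3 f h w) :
    MonotoneOn (fun x => scaledGeomMean n x * w x) (closedCube n ∩ grid n h) := by
  intro x hx y hy hxy
  revert hxy
  revert y
  refine grid_induction hh fun y hy ih hxy => ?_
  by_cases heq : x = y
  · rw [heq]
  obtain ⟨i, hi⟩ : ∃ i, x i < y i := by
    by_contra! hcon
    exact heq (le_antisymm hxy hcon)
  have hyi : y i ≠ 0 := ((hx.1 i).1.trans_lt hi).ne'
  refine (ih i hyi fun j => ?_).trans (hw.scaledGeomMean_mul_sub_le hn hh hy hyi)
  rw [sub_smul_single_apply]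
  split_ifs with hj
  · subst hj
    obtain ⟨k, hk⟩ := hx.2 j
    obtain ⟨l, hl⟩ := hy.2 j
    rw [hk, hl] at hi ⊢
    have h1 : k < l := by exact_mod_cast lt_of_mul_lt_mul_left hi hh.le
    have h2 : (k : ℝ) + 1 ≤ l := by exact_mod_cast h1
    nlinarith
  · simpa using hxy j

theorem GridTendstoUniformly.tendsto_gridFloor {n : ℕ} {v : ℝ → (Fin n → ℝ) → ℝ}
    {w : (Fin n → ℝ) → ℝ} (H : GridTendstoUniformly v w) (hw : ContinuousOn w (closedCube n))
    {h : ℕ → ℝ} (hh : ∀ m, 0 < h m) (hlim : Filter.Tendsto h Filter.atTop (nhds 0))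
    {x : Fin n → ℝ} (hx : x ∈ closedCube n) :
    Filter.Tendsto (fun m => v (h m) (gridFloor (h m) x)) Filter.atTop (nhds (w x)) := by
  have h1 := (hw x hx).tendsto.comp (tendsto_nhdsWithin_iff.2
    ⟨_root_.tendsto_gridFloor hh hlim x, Filter.Eventually.of_forall fun m =>
      (gridFloor_mem (hh m) hx).1⟩)
  have h2 : Filter.Tendsto (fun m => v (h m) (gridFloor (h m) x) - w (gridFloor (h m) x))
      Filter.atTop (nhds 0) := by
    rw [Metric.tendsto_atTop']
    intro ε hε
    obtain ⟨h₀, hh₀, H'⟩ := H ε hε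
    obtain ⟨N, hN⟩ := Filter.eventually_atTop.1 (hlim.eventually_lt_const hh₀)
    refine ⟨N, fun m hm => ?_⟩
    rw [Real.dist_eq, sub_zero]
    exact H' _ (hh m) (hN m hm.le) _ (gridFloor_mem (hh m) hx)
  simpa using h2.add h1

theorem GridTendstoUniformly.monotoneOn_scaledGeomMean_mul {n : ℕ} (hn : 1 ≤ n)
    {f : (Fin n → ℝ) → ℝ} {v : ℝ → (Fin n → ℝ) → ℝ}
    (hv : ∀ h, 0 < h → IsMaximalSolutionS3 f h (v h)) {w : (Fin n → ℝ) → ℝ}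
    (H : GridTendstoUniformly v w) (hw : ContinuousOn w (closedCube n)) :
    MonotoneOn (fun x => scaledGeomMean n x * w x) (closedCube n) := by
  intro x hx y hy hxy
  have hlim := tendsto_one_div_add_atTop_nhds_zero_nat (𝕜 := ℝ)
  have hpos : ∀ m : ℕ, 0 < 1 / ((m : ℝ) + 1) := fun m => by positivity
  have ht : ∀ z ∈ closedCube n, Filter.Tendsto (fun m : ℕ =>
      scaledGeomMean n (gridFloor (1 / ((m : ℝ) + 1)) z) *
        v (1 / ((m : ℝ) + 1)) (gridFloor (1 / ((m : ℝ) + 1)) z)) Filter.atTop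
      (nhds (scaledGeomMean n z * w z)) := fun z hz =>
    (((continuous_scaledGeomMean n).tendsto z).comp (_root_.tendsto_gridFloor hpos hlim z)).mul
      (H.tendsto_gridFloor hw hpos hlim hz)
  exact le_of_tendsto_of_tendsto' (ht x hx) (ht y hy) fun m =>
    (hv _ (hpos m)).monotoneOn_scaledGeomMean_mul hn (hpos m) (gridFloor_mem (hpos m) hx)
      (gridFloor_mem (hpos m) hy) (gridFloor_mono (hpos m) hxy)

/-! ### Comparison principle for the transformed equation. -/

theorem grad_quadratic {n : ℕ} (a b : ℝ) (c x : Fin n → ℝ) (i : Fin n) :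
    grad (fun y => a * ∑ j, (y j - c j) ^ 2 + b * ∑ j, y j) x i = 2 * a * (x i - c i) + b := by
  have hc : ∀ j, HasFDerivAt (fun y : Fin n → ℝ => y j)
      (ContinuousLinearMap.proj (R := ℝ) (φ := fun _ : Fin n => ℝ) j) x := fun j =>
    hasFDerivAt_apply j x
  have h1 : HasFDerivAt (fun y : Fin n → ℝ => a * ∑ j, (y j - c j) ^ 2 + b * ∑ j, y j) _ x :=
    ((HasFDerivAt.fun_sum fun j (_ : j ∈ Finset.univ) => ((hc j).sub_const (c j)).pow 2).const_mul
      a).add ((HasFDerivAt.fun_sum fun j (_ : j ∈ Finset.univ) => hc j).const_mul b)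
  rw [grad, h1.fderiv]
  simp [Pi.single_apply]
  ring

theorem contDiff_quadratic {n : ℕ} (a b : ℝ) (c : Fin n → ℝ) :
    ContDiff ℝ 1 fun y : Fin n → ℝ => a * ∑ j, (y j - c j) ^ 2 + b * ∑ j, y j := by
  fun_prop

theorem mem_gammaBdry_of_notMem_cube {n : ℕ} {x : Fin n → ℝ} (hx : x ∈ closedCube n)
    (h : x ∉ cube n) : x ∈ gammaBdry n := by
  refine ⟨hx, ?_⟩
  by_contra! hcon
  exact h fun i => ⟨lt_of_le_of_ne (hx i).1 (hcon i).symm, (hx i).2⟩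

/-- Comparison of a subsolution with a nondecreasing supersolution. -/
theorem IsViscositySubsolution.le_of_monotoneOn {n : ℕ} (hn : 1 ≤ n) {f U V : (Fin n → ℝ) → ℝ}
    (hf : ContinuousOn f (closedCube n)) (hUc : ContinuousOn U (closedCube n))
    (hVc : ContinuousOn V (closedCube n)) (hVm : MonotoneOn V (closedCube n))
    (hU : IsViscositySubsolution (hamiltonianP1 f) (cube n) U)
    (hV : IsViscositySupersolution (hamiltonianP1 f) (cube n) V)
    (hUV : ∀ x ∈ gammaBdry n, U x ≤ V x) : ∀ x ∈ closedCube n, U x ≤ V x := by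
  intro z hz
  by_contra! hlt
  have hn0 : (0 : ℝ) < n := by exact_mod_cast hn
  have hK := isCompact_closedCube n
  set σ := (U z - V z) / 2 with hσ
  have hσpos : 0 < σ := by rw [hσ]; linarith
  -- The linear term `ε ∑ y i` separates the two gradients by `ε` in each coordinate; this size
  -- keeps it at most `σ` on the cube, so the penalised maximum remains at least `σ`.
  set ε := σ / n with hε
  have hεpos : 0 < ε := by positivity
  obtain ⟨ρ₁, hρ₁, hUu⟩ := Metric.uniformContinuousOn_iff.1
    (hK.uniformContinuousOn_of_continuous hUc) σ hσpos
  obtain ⟨ρ₂, hρ₂, hVu⟩ := Metric.uniformContinuousOn_iff.1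
    (hK.uniformContinuousOn_of_continuous hVc) σ hσpos
  obtain ⟨ρ₃, hρ₃, hfu⟩ := Metric.uniformContinuousOn_iff.1
    (hK.uniformContinuousOn_of_continuous hf) (ε ^ n) (by positivity)
  set ρ := min ρ₁ (min ρ₂ ρ₃) with hρ
  have hρpos : 0 < ρ := by positivity
  obtain ⟨BU, hBU⟩ := hK.exists_bound_of_continuousOn hUc
  obtain ⟨BV, hBV⟩ := hK.exists_bound_of_continuousOn hVc
  have hB0 : 0 ≤ BU + BV := by
    linarith [norm_nonneg (U z), norm_nonneg (V z), hBU z hz, hBV z hz]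
  set m := (BU + BV + 1) / ρ ^ 2 with hm
  have hmpos : 0 < m := by positivity
  obtain ⟨⟨x, y⟩, ⟨hx, hy⟩, hmax⟩ := (hK.prod hK).exists_isMaxOn
    (f := fun p : (Fin n → ℝ) × (Fin n → ℝ) =>
      U p.1 - V p.2 - ε * ∑ i, p.2 i - m * ∑ i, (p.1 i - p.2 i) ^ 2) ⟨(z, z), hz, hz⟩ (by
    refine ContinuousOn.sub (ContinuousOn.sub (ContinuousOn.sub ?_ ?_) ?_) ?_
    · exact hUc.comp continuousOn_fst fun p hp => hp.1
    · exact hVc.comp continuousOn_snd fun p hp => hp.2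
    · exact Continuous.continuousOn (by fun_prop)
    · exact Continuous.continuousOn (by fun_prop))
  simp only at hx hy
  have hmax' : ∀ a ∈ closedCube n, ∀ b ∈ closedCube n,
      U a - V b - ε * ∑ i, b i - m * ∑ i, (a i - b i) ^ 2 ≤
        U x - V y - ε * ∑ i, y i - m * ∑ i, (x i - y i) ^ 2 := fun a ha b hb =>
    hmax (show (a, b) ∈ closedCube n ×ˢ closedCube n from ⟨ha, hb⟩)
  have hsz : ∑ i, z i ≤ n := by
    have := Finset.sum_le_card_nsmul Finset.univ (fun i => z i) 1 fun i _ => (hz i).2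
    simpa using this
  have hsy : 0 ≤ ε * ∑ i, y i :=
    mul_nonneg hεpos.le (Finset.sum_nonneg fun i _ => (hy i).1)
  have hS : 0 ≤ m * ∑ i, (x i - y i) ^ 2 :=
    mul_nonneg hmpos.le (Finset.sum_nonneg fun i _ => sq_nonneg _)
  have hval : σ + ε * ∑ i, y i + m * ∑ i, (x i - y i) ^ 2 ≤ U x - V y := by
    have h1 := hmax' z hz z hz
    have h2 : ε * ∑ i, z i ≤ σ := by
      calc ε * ∑ i, z i ≤ ε * n := mul_le_mul_of_nonneg_left hsz hεpos.le
        _ = σ := by rw [hε]; field_simp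
    simp only [sub_self, ne_eq, OfNat.ofNat_ne_zero, not_false_eq_true, zero_pow,
      Finset.sum_const_zero, mul_zero, sub_zero] at h1
    linarith
  have hdist : dist x y < ρ := by
    apply dist_lt_of_sum_sq_lt hρpos
    have h1 := abs_le.1 (hBU x hx)
    have h2 := abs_le.1 (hBV y hy)
    have h3 : m * ∑ i, (x i - y i) ^ 2 < BU + BV + 1 := by linarith
    rw [hm, div_mul_eq_mul_div, div_lt_iff₀ (by positivity)] at h3
    exact lt_of_mul_lt_mul_left h3 (by positivity)
  have hUd := abs_lt.1 (hUu x hx y hy (hdist.trans_le (min_le_left _ _)))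
  have hVd := abs_lt.1 (hVu x hx y hy
    (hdist.trans_le ((min_le_right _ _).trans (min_le_left _ _))))
  have hfd := abs_lt.1 (hfu x hx y hy
    (hdist.trans_le ((min_le_right _ _).trans (min_le_right _ _))))
  -- On `gammaBdry n` the boundary inequality and the oscillation bound `σ` would contradict `hval`.
  have hxc : x ∈ cube n := by
    by_contra hcon
    linarith [hUV x (mem_gammaBdry_of_notMem_cube hx hcon)]
  have hyc : y ∈ cube n := by
    by_contra hcon
    linarith [hUV y (mem_gammaBdry_of_notMem_cube hy hcon)]
  have hsub := hU.2 x hxc _ (contDiff_quadratic m 0 y) (by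
    filter_upwards [self_mem_nhdsWithin] with a ha
    have := hmax' a (cube_subset_closedCube n ha) y hy
    linarith)
  have hcomm : ∀ b : Fin n → ℝ, ∑ i, (x i - b i) ^ 2 = ∑ i, (b i - x i) ^ 2 := fun b =>
    Finset.sum_congr rfl fun i _ => by ring
  have hsup := hV.2 y hyc _ (contDiff_quadratic (-m) (-ε) x) (by
    filter_upwards [self_mem_nhdsWithin] with b hb
    have := hmax' x hx b (cube_subset_closedCube n hb)
    simp only [hcomm] at this
    linarith)
  -- Monotonicity of `V` is used here, by moving `y` backwards. Otherwise the positive part could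
  -- erase negative factors and no gap in the product would follow.
  have hgrad : ∀ i, 0 ≤ 2 * -m * (y i - x i) + -ε := fun i => by
    have hstep : ∀ᶠ t in nhdsWithin (0 : ℝ) (Ioi 0), 0 ≤ 2 * -m * (y i - x i) + -ε + m * t := by
      filter_upwards [Ioo_mem_nhdsGT (hyc i).1] with t ht
      have hmem : y - t • (Pi.single i 1 : Fin n → ℝ) ∈ closedCube n := fun j => by
        rw [sub_smul_single_apply]
        split_ifs with hj
        · subst hj
          exact ⟨by linarith [ht.2], by linarith [ht.1, (hy j).2]⟩
        · simpa using hy j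
      have h1 := hmax' x hx _ hmem
      have h2 := hVm hmem hy fun j => by
        rw [sub_smul_single_apply]
        split_ifs <;> linarith [ht.1]
      have h3 : ∑ j, (y - t • (Pi.single i 1 : Fin n → ℝ)) j = ∑ j, y j - t := by
        simp only [sub_smul_single_apply, Finset.sum_sub_distrib, Finset.sum_ite_eq',
          Finset.mem_univ, if_true]
      rw [hcomm, hcomm, sum_sq_sub_single, h3] at h1
      have h4 : 0 ≤ t * (2 * -m * (y i - x i) + -ε + m * t) := by nlinarith
      exact nonneg_of_mul_nonneg_right h4 ht.1
    have hlim : Filter.Tendsto (fun t : ℝ => 2 * -m * (y i - x i) + -ε + m * t)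
        (nhdsWithin 0 (Ioi 0)) (nhds (2 * -m * (y i - x i) + -ε + m * 0)) :=
      ((continuous_const.add (continuous_const.mul continuous_id)).tendsto 0).mono_left
        nhdsWithin_le_nhds
    simpa using ge_of_tendsto hlim hstep
  simp only [hamiltonianP1, grad_quadratic] at hsub hsup
  have h1 : ∏ i, max (2 * -m * (y i - x i) + -ε) 0 = ∏ i, (2 * -m * (y i - x i) + -ε) :=
    Finset.prod_congr rfl fun i _ => max_eq_left (hgrad i)
  have h2 := prod_add_pow_le_prod hn hεpos.le hgrad
    (a := fun i => max (2 * m * (x i - y i) + 0) 0) fun i =>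
      le_max_of_le_left (by linarith)
  linarith

/-! ### Conclusion. -/

theorem mainTheorem5 (n : ℕ) (hn : 1 ≤ n) (f : (Fin n → ℝ) → ℝ)
    (hf : ContinuousOn f (closedCube n)) (hf_nonneg : ∀ x ∈ closedCube n, 0 ≤ f x) :
    (∀ h : ℝ, 0 < h →
      (∃ w_h : (Fin n → ℝ) → ℝ, IsMaximalSolutionS3 f h w_h) ∧
      ∀ w₁ w₂ : (Fin n → ℝ) → ℝ, IsMaximalSolutionS3 f h w₁ → IsMaximalSolutionS3 f h w₂ →
        EqOn w₁ w₂ (closedCube n ∩ grid n h)) ∧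
    ∃ w : (Fin n → ℝ) → ℝ,
      IsMaximalBoundedSolutionP3 f w ∧
      (∃ u : (Fin n → ℝ) → ℝ, IsNondecreasingSolutionP1 f u) ∧
      (∀ u : (Fin n → ℝ) → ℝ, IsNondecreasingSolutionP1 f u →
        ∀ x ∈ cube n, u x = n * (∏ i, x i) ^ (1 / (n : ℝ)) * w x) ∧
      ∀ ε : ℝ, 0 < ε → ∃ h₀ : ℝ, 0 < h₀ ∧ ∀ h : ℝ, 0 < h → h < h₀ →
        ∀ w_h : (Fin n → ℝ) → ℝ, IsMaximalSolutionS3 f h w_h →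
          ∀ x ∈ cube n ∩ grid n h, |w_h x - w x| < ε := by
  refine ⟨fun h hh => ⟨exists_isMaximalSolutionS3 hn hf_nonneg hh, fun w₁ w₂ h₁ h₂ =>
    h₁.eqOn hh h₂⟩, ?_⟩
  obtain ⟨B, hB⟩ := (isCompact_closedCube n).exists_bound_of_continuousOn hf
  have hfM : ∀ x ∈ closedCube n, f x ≤ max B 1 := fun x hx =>
    (le_abs_self _).trans ((hB x hx).trans (le_max_left _ _))
  choose! v hv using fun h (hh : 0 < h) => exists_isMaximalSolutionS3 hn hf_nonneg hh
  obtain ⟨w, hwc, hwb, hvw⟩ := exists_gridTendstoUniformly hn hf (le_max_right B 1) hfM hv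
  have hsub := cube_subset_closedCube n
  have hwsol := viscosity_limit hf hv hvw hwc
  have hub : ∀ x ∈ gammaBdry n, scaledGeomMean n x * w x = 0 := fun x hx => by
    rw [scaledGeomMean_eq_zero hn hx, zero_mul]
  have hu : IsNondecreasingSolutionP1 f fun x => scaledGeomMean n x * w x :=
    { continuousOn := (continuous_scaledGeomMean n).continuousOn.mul hwc
      monotoneOn := hvw.monotoneOn_scaledGeomMean_mul hn hv hwc
      viscosity := ⟨hwsol.1.scaledGeomMean_mul hn (hwc.mono hsub),
        hwsol.2.scaledGeomMean_mul hn (hwc.mono hsub)⟩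
      boundary := hub }
  refine ⟨w, ⟨⟨hwsol, max B 1, fun x hx => ?_⟩, ?_⟩, ⟨_, hu⟩, ?_, ?_⟩
  · rw [abs_of_nonneg (hwb x (hsub hx)).1]
    exact (hwb x (hsub hx)).2
  -- Nothing is known about the monotonicity or sign of `w'`; being a subsolution after scaling
  -- suffices for comparison with the nondecreasing `u`.
  · rintro w' ⟨hw', C, hC⟩ x hx
    have hwc' : ContinuousOn w' (cube n) :=
      continuousOn_iff_lower_upperSemicontinuousOn.2 ⟨hw'.2.1, hw'.1.1⟩
    have := (hw'.1.scaledGeomMean_mul hn hwc').le_of_monotoneOn hn hf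
      (continuousOn_scaledGeomMean_mul hn hwc' hC) hu.continuousOn hu.monotoneOn hu.viscosity.2
      (fun y hy => by rw [hub y hy, scaledGeomMean_eq_zero hn hy, zero_mul]) x (hsub hx)
    exact le_of_mul_le_mul_left this (scaledGeomMean_pos hn fun i => (hx i).1)
  · intro u hu' x hx
    refine le_antisymm ?_ ?_
    · exact hu'.viscosity.1.le_of_monotoneOn hn hf hu'.continuousOn hu.continuousOn hu.monotoneOn
        hu.viscosity.2 (fun y hy => by rw [hub y hy, hu'.boundary y hy]) x (hsub hx)
    · exact hu.viscosity.1.le_of_monotoneOn hn hf hu.continuousOn hu'.continuousOn hu'.monotoneOn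
        hu'.viscosity.2 (fun y hy => by rw [hub y hy, hu'.boundary y hy]) x (hsub hx)
  · intro ε hε
    obtain ⟨h₀, hh₀, H⟩ := hvw ε hε
    refine ⟨h₀, hh₀, fun h hh hlt w_h hw_h x hx => ?_⟩
    have hxK : x ∈ closedCube n ∩ grid n h := ⟨hsub hx.1, hx.2⟩
    rw [hw_h.eqOn hh (hv h hh) hxK]
    exact H h hh hlt x hxK
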